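/- **The logic QHC.** Formulas are of two sorts, c-formulas and i-formulas. For each $n\ge 0$ there are countably many $n$-ary predicate variables of each sort, and there are countably many individual variables $x,y,\dots$. c-formulas are built from $\top$, $\bot$, atoms $p(x_1,\dots,x_n)$ and formulas $?\Phi$ ($\Phi$ an i-formula) by the classical connectives and quantifiers $\land,\lor,\to,\forall,\exists$; i-formulas are built from $\checkmark$ (triviality), $\curlywedge$ (absurdity), atoms $\alpha(x_1,\dots,x_n)$ and formulas $!F$ ($F$ a c-formula) by the intuitionistic connectives and quantifiers $\land,\lor,\to,\forall,\exists$. In either sort $\neg A$ abbreviates $A\to\bot$ (resp. $A\to\curlywedge$), and $A\leftrightarrow B$ abbreviates $(A\to B)\land(B\to A)$. QHC has all laws and inference rules of classical predicate logic, applied to arbitrary c-formulas; all laws and inference rules of intuitionistic predicate logic, applied to arbitrary i-formulas; and, for all c-formulas $F,G$ and i-formulas $\Phi,\Psi$, the laws $$?(\Phi\land\Psi)\leftrightarrow\,?\Phi\,\land\,?\Psi,\quad ?(\Phi\lor\Psi)\leftrightarrow\,?\Phi\,\lor\,?\Psi,\quad ?(\Phi\to\Psi)\to(?\Phi\to\,?\Psi),\quad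 \neg\,?\curlywedge,$$ $$?\exists x\,\Phi\leftrightarrow\exists x\,?\Phi,\quad ?\forall x\,\Phi\to\forall x\,?\Phi,\quad \Phi\to\,!?\Phi,$$ $$\neg\,!\bot,\quad ?!F\to F,\quad !F\to\,!?!F,\quad !(F\to G)\to(!F\to\,!G),$$ and the inference rules $!F\,/\,F$ and $F\,/\,!F$. Write $\Gamma\vdash A$ if the formula $A$ is derivable in QHC from the set of formulas $\Gamma$, where in the quantifier rules the variable being bound must not occur freely in the premisses from $\Gamma$ that are used. **Structures.** Fix a topological space $X$ and a nonempty set $D$. Formulas are interpreted by families indexed by the assignments of elements of $D$ to the individual variables, and an $n$-ary predicate variable by an arbitrary $D^n$-indexed family. In the *subset/sheaf-valued structure*, c-formulas are interpreted by families of subsets of $X$, with $\top,\bot,\land,\lor,\to,\forall,\exists$ interpreted by $X$, $\varnothing$, $P\cap Q$, $P\cup Q$, $(X\setminus P)\cup Q$, $\bigcap_{d\in D}$, $\bigcup_{d\in D}$; and i-formulas are interpreted by families of sheaves of sets on $X$, with $\checkmark,\curlywedge$ interpreted by the terminal and the initial sheaf, and $\land,\lor,\to,\forall,\exists$ interpreted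 by the product $\mathcal F\times\mathcal G$, the coproduct $\mathcal F\sqcup\mathcal G$, the sheaf $\mathcal{H}om(\mathcal F,\mathcal G)$, the product $\prod_{d\in D}$ and the coproduct $\bigsqcup_{d\in D}$ of sheaves. The operator $!$ takes a subset $P$ to the sheaf of continuous sections of the inclusion $\operatorname{Int}P\to X$, and $?$ takes a sheaf $\mathcal F$ to the set of all $x\in X$ such that the stalk $\mathcal F_x$ is nonempty. A c-formula is valid under an assignment if its value is $X$; an i-formula is valid under an assignment if its value has a global section. The *subset/presheaf-valued structure* is described in the same way with, instead of sheaves, presheaves of sets $\mathcal F$ on $X$ such that $\mathcal F(\varnothing)\ne\varnothing$. Here $\checkmark$ is interpreted by the terminal presheaf, $\land,\lor,\forall,\exists$ by products and coproducts of presheaves (formed separately over each open set), $\to$ by the presheaf $U\mapsto\operatorname{Hom}(\mathcal F|_U,\mathcal G|_U)$, $\curlywedge$ by the presheaf of sections of $\varnothing\to X$, $!P$ by the presheaf of continuous sections of $\operatorname{Int}P\to X$, and $?$ and validity are defined by stalks and global sections as before. **Theorem.** For every topological space $X$ and every nonempty set $D$, the subset/sheaf-valued structure and the subset/presheaf-valued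 structure are models of QHC: if $\Gamma\vdash A$ in QHC, then for every interpretation of the predicate variables and every assignment of elements of $D$ to the individual variables under which all formulas of $\Gamma$ are valid, $A$ is valid under it too. In particular, every formula derivable in QHC is valid for every interpretation of the predicate variables and every assignment. -/

import Mathlib

open CategoryTheory CategoryTheory.Limits TopologicalSpace Opposite

universe u

namespace QHC

/-! ### The language -/

/-- The two sorts of formulas: `c` (propositions) and `i` (problems). -/
inductive Kind : Type
  | c
  | i

/-- Formulas of QHC, indexed by their sort. Individual variables are de Bruijn indices:
`all A` and `ex A` bind the variable `0` of `A`, and the variable `n + 1` of `A` is the variable `n`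
of `all A` and `ex A`. `atom s k p t` is the `p`-th `k`-ary predicate variable of sort `s` (a proper
predicate variable for `s = c`, a problem variable for `s = i`) applied to individual variables.
`verum` and `falsum` are truth and falsity for `c`, triviality and absurdity for `i`. -/
inductive Formula : Kind → Type
  | atom (s : Kind) (k p : ℕ) (t : Fin k → ℕ) : Formula s
  | verum (s : Kind) : Formula s
  | falsum (s : Kind) : Formula s
  | and {s : Kind} (A B : Formula s) : Formula s
  | or {s : Kind} (A B : Formula s) : Formula s
  | imp {s : Kind} (A B : Formula s) : Formula s
  | all {s : Kind} (A : Formula s) : Formula s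
  | ex {s : Kind} (A : Formula s) : Formula s
  | bang (F : Formula Kind.c) : Formula Kind.i
  | wn (Φ : Formula Kind.i) : Formula Kind.c

namespace Formula

/-- Negation `A → ⊥`. -/
def neg {s : Kind} (A : Formula s) : Formula s := imp A (falsum s)

/-- Equivalence `(A → B) ∧ (B → A)`. -/
def iff {s : Kind} (A B : Formula s) : Formula s := and (imp A B) (imp B A)

/-- Extension of a renaming of variables under a binder. -/
def liftVar (f : ℕ → ℕ) : ℕ → ℕ
  | 0 => 0
  | n + 1 => f n + 1

/-- Renaming of the free individual variables (capture-avoiding). -/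
def rename : {s : Kind} → Formula s → (ℕ → ℕ) → Formula s
  | _, atom s k p t, f => atom s k p (fun j => f (t j))
  | _, verum s, _ => verum s
  | _, falsum s, _ => falsum s
  | _, and A B, f => and (A.rename f) (B.rename f)
  | _, or A B, f => or (A.rename f) (B.rename f)
  | _, imp A B, f => imp (A.rename f) (B.rename f)
  | _, all A, f => all (A.rename (liftVar f))
  | _, ex A, f => ex (A.rename (liftVar f))
  | _, bang F, f => bang (F.rename f)
  | _, wn Φ, f => wn (Φ.rename f)

/-- `A` regarded as a formula in which the variable `0` does not occur freely. -/
def shift {s : Kind} (A : Formula s) : Formula s := A.rename Nat.succ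

/-- The body `A` of a quantified formula with the individual variable `x` put in for the
bound variable. -/
def inst {s : Kind} (A : Formula s) (x : ℕ) : Formula s :=
  A.rename (fun n => Nat.casesOn n x (fun m => m))

end Formula

/-- A formula of either sort. -/
abbrev AnyFormula : Type := Σ s : Kind, Formula s

open Formula

/-! ### The derivation system -/

/-- The laws of QHC, with metavariables ranging over all formulas of the appropriate sort. -/
inductive Law : {s : Kind} → Formula s → Prop
  -- laws of intuitionistic predicate logic, for formulas of either sort
  | imp_k {s : Kind} (A B : Formula s) : Law (imp A (imp B A))
  | imp_s {s : Kind} (A B C : Formula s) :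
      Law (imp (imp A (imp B C)) (imp (imp A B) (imp A C)))
  | and_left {s : Kind} (A B : Formula s) : Law (imp (and A B) A)
  | and_right {s : Kind} (A B : Formula s) : Law (imp (and A B) B)
  | and_intro {s : Kind} (A B : Formula s) : Law (imp A (imp B (and A B)))
  | or_left {s : Kind} (A B : Formula s) : Law (imp A (or A B))
  | or_right {s : Kind} (A B : Formula s) : Law (imp B (or A B))
  | or_elim {s : Kind} (A B C : Formula s) :
      Law (imp (imp A C) (imp (imp B C) (imp (or A B) C)))
  | explosion {s : Kind} (A : Formula s) : Law (imp (falsum s) A)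
  | verum (s : Kind) : Law (Formula.verum s)
  | all_elim {s : Kind} (A : Formula s) (x : ℕ) : Law (imp (all A) (A.inst x))
  | ex_intro {s : Kind} (A : Formula s) (x : ℕ) : Law (imp (A.inst x) (ex A))
  -- excluded middle, for c-formulas only
  | em (F : Formula Kind.c) : Law (or F (neg F))
  -- laws for `?`
  | wn_and (Φ Ψ : Formula Kind.i) : Law (iff (wn (and Φ Ψ)) (and (wn Φ) (wn Ψ)))
  | wn_or (Φ Ψ : Formula Kind.i) : Law (iff (wn (or Φ Ψ)) (or (wn Φ) (wn Ψ)))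
  | wn_imp (Φ Ψ : Formula Kind.i) : Law (imp (wn (imp Φ Ψ)) (imp (wn Φ) (wn Ψ)))
  | wn_absurd : Law (neg (wn (falsum Kind.i)))
  | wn_ex (Φ : Formula Kind.i) : Law (iff (wn (ex Φ)) (ex (wn Φ)))
  | wn_all (Φ : Formula Kind.i) : Law (imp (wn (all Φ)) (all (wn Φ)))
  | bang_wn (Φ : Formula Kind.i) : Law (imp Φ (bang (wn Φ)))
  -- laws for `!`
  | bang_false : Law (neg (bang (falsum Kind.c)))
  | wn_bang (F : Formula Kind.c) : Law (imp (wn (bang F)) F)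
  | bang_wn_bang (F : Formula Kind.c) : Law (imp (bang F) (bang (wn (bang F))))
  | bang_imp (F G : Formula Kind.c) : Law (imp (bang (imp F G)) (imp (bang F) (bang G)))

/-- The formulas of `Γ`, regarded as formulas in which the variable `0` does not occur freely. -/
def shiftAll (Γ : Set AnyFormula) : Set AnyFormula :=
  (fun B : AnyFormula => (⟨B.1, B.2.shift⟩ : AnyFormula)) '' Γ

/-- `Derives Γ A`: the formula `A` is derivable in QHC from the premisses `Γ`, whose free individual
variables are held fixed. In the two quantifier rules the premisses are shifted, which
expresses that the variable to be bound does not occur freely in them. -/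
inductive Derives : Set AnyFormula → {s : Kind} → Formula s → Prop
  | hyp {Γ : Set AnyFormula} {s : Kind} {A : Formula s} (h : (⟨s, A⟩ : AnyFormula) ∈ Γ) :
      Derives Γ A
  | law {Γ : Set AnyFormula} {s : Kind} {A : Formula s} (h : Law A) : Derives Γ A
  | mp {Γ : Set AnyFormula} {s : Kind} {A B : Formula s}
      (h₁ : Derives Γ (imp A B)) (h₂ : Derives Γ A) : Derives Γ B
  | all_rule {Γ : Set AnyFormula} {s : Kind} {A B : Formula s}
      (h : Derives (shiftAll Γ) (imp A.shift B)) : Derives Γ (imp A (all B))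
  | ex_rule {Γ : Set AnyFormula} {s : Kind} {A B : Formula s}
      (h : Derives (shiftAll Γ) (imp B A.shift)) : Derives Γ (imp (ex B) A)
  | bang_elim {Γ : Set AnyFormula} {F : Formula Kind.c}
      (h : Derives Γ (bang F)) : Derives Γ F
  | bang_intro {Γ : Set AnyFormula} {F : Formula Kind.c}
      (h : Derives Γ F) : Derives Γ (bang F)

/-! ### Structures in which c-formulas are interpreted by subsets of a space -/

/-- Operations on `V` interpreting the constants, connectives and quantifiers of one sort, the
quantifiers ranging over the domain `D`. -/
structure Connectives (D : Type u) (V : Type (u + 1)) where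
  verum : V
  falsum : V
  and : V → V → V
  or : V → V → V
  imp : V → V → V
  all : (D → V) → V
  ex : (D → V) → V

/-- The Leibniz–Euler–Venn interpretation of classical logic by arbitrary subsets of `X`. -/
def subsetConnectives (X D : Type u) : Connectives D (ULift.{u + 1} (Set X)) where
  verum := ⟨Set.univ⟩
  falsum := ⟨∅⟩
  and P Q := ⟨P.down ∩ Q.down⟩
  or P Q := ⟨P.down ∪ Q.down⟩
  imp P Q := ⟨P.downᶜ ∪ Q.down⟩
  all P := ⟨⋂ d, (P d).down⟩
  ex P := ⟨⋃ d, (P d).down⟩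

/-- A structure for the language of QHC with domain `D`, in which c-formulas are interpreted by
subsets of `X`: what i-formulas are interpreted by, which operations interpret the intuitionistic
connectives and the operators `!` and `?`, and which values of i-formulas count as valid. -/
structure Struc (X D : Type u) where
  Obj : Type (u + 1)
  conn : Connectives D Obj
  bang : Set X → Obj
  wn : Obj → Set X
  Solvable : Obj → Prop

namespace Struc

variable {X D : Type u}

/-- The values of formulas of sort `s`. -/
def Val (M : Struc X D) : Kind → Type (u + 1)
  | Kind.c => ULift.{u + 1} (Set X)
  | Kind.i => M.Obj

/-- The operations on values of sort `s`. -/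
def ops (M : Struc X D) : (s : Kind) → Connectives D (M.Val s)
  | Kind.c => subsetConnectives X D
  | Kind.i => M.conn

/-- The values that count as valid: the whole space for c-formulas. -/
def Valid (M : Struc X D) : (s : Kind) → M.Val s → Prop
  | Kind.c, P => P.down = Set.univ
  | Kind.i, F => M.Solvable F

/-- An interpretation of the predicate variables: the `p`-th `k`-ary predicate variable of sort `s`
is interpreted by a `Dᵏ`-indexed family of values. -/
abbrev Valuation (M : Struc X D) : Type (u + 1) :=
  (s : Kind) → (k : ℕ) → ℕ → (Fin k → D) → M.Val s

/-- Assignment of `d` to the variable `0`, the others being moved up. -/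
def cons (d : D) (e : ℕ → D) : ℕ → D
  | 0 => d
  | n + 1 => e n

/-- The interpretation of a formula, as a family of values indexed by the assignments of elements
of `D` to the individual variables. -/
def eval (M : Struc X D) (v : M.Valuation) : {s : Kind} → Formula s → (ℕ → D) → M.Val s
  | _, Formula.atom s k p t, e => v s k p (fun j => e (t j))
  | _, Formula.verum s, _ => (M.ops s).verum
  | _, Formula.falsum s, _ => (M.ops s).falsum
  | s, Formula.and A B, e => (M.ops s).and (M.eval v A e) (M.eval v B e)
  | s, Formula.or A B, e => (M.ops s).or (M.eval v A e) (M.eval v B e)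
  | s, Formula.imp A B, e => (M.ops s).imp (M.eval v A e) (M.eval v B e)
  | s, Formula.all A, e => (M.ops s).all (fun d => M.eval v A (cons d e))
  | s, Formula.ex A, e => (M.ops s).ex (fun d => M.eval v A (cons d e))
  | _, Formula.bang F, e => M.bang (M.eval v F e).down
  | _, Formula.wn Φ, e => ⟨M.wn (M.eval v Φ e)⟩

/-- `M` is a model of QHC: whatever is derivable in QHC from premisses holds in `M` whenever the
premisses do, for every interpretation of the predicate variables and every assignment of elements
of the domain to the individual variables. With no premisses this says that every derivable formula
is interpreted by a family all of whose members are valid. -/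
def IsModel (M : Struc X D) : Prop :=
  ∀ (Γ : Set AnyFormula) (s : Kind) (A : Formula s), Derives Γ A →
    ∀ (v : M.Valuation) (e : ℕ → D),
      (∀ B ∈ Γ, M.Valid B.1 (M.eval v B.2 e)) → M.Valid s (M.eval v A e)

end Struc

/-! ### Sheaves and presheaves of sets -/

noncomputable section

/-- The category of sheaves of sets on `X`. -/
abbrev Sh (X : TopCat.{u}) : Type (u + 1) := Sheaf (Opens.grothendieckTopology X) (Type u)

instance (X : TopCat.{u}) : HasInitial (Sh X) := Sheaf.instHasColimitsOfShape

instance (X : TopCat.{u}) : HasTerminal (Sh X) := Sheaf.instHasLimitsOfShape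

instance (X : TopCat.{u}) : HasBinaryProducts (Sh X) := Sheaf.instHasLimitsOfShape

instance (X : TopCat.{u}) : HasBinaryCoproducts (Sh X) := Sheaf.instHasColimitsOfShape

instance (X : TopCat.{u}) (D : Type u) : HasProductsOfShape D (Sh X) :=
  Sheaf.instHasLimitsOfShape

instance (X : TopCat.{u}) (D : Type u) : HasCoproductsOfShape D (Sh X) :=
  Sheaf.instHasColimitsOfShape

/-- The sheaf of continuous sections of the inclusion of the interior of `P` into `X`. -/
def interiorSheaf (X : TopCat.{u}) (P : Set X) : Sh X :=
  TopCat.subsheafToTypes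
    ((TopCat.continuousLocal X (interior P)).and
      (TopCat.isSection (fun y : interior P => (y : X))))

theorem nonempty_interiorSheaf (X : TopCat.{u}) (P : Set X) :
    Nonempty ((interiorSheaf X P).obj.obj (op ⊥)) :=
  ⟨⟨fun x => False.elim x.2,
    continuous_iff_continuousAt.2 (fun x => False.elim x.2), funext fun x => False.elim x.2⟩⟩

/-- The set of points at which the stalk of a presheaf is nonempty. -/
def stalkSupport {X : TopCat.{u}} (F : TopCat.Presheaf (Type u) X) : Set X :=
  {x | Nonempty (F.stalk x)}

/-- The subset/sheaf-valued structure over `X` with domain `D`. The constants, conjunction,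
disjunction and quantifiers are interpreted by terminal and initial objects, products and
coproducts in the category of sheaves, and implication by the sheaf of homomorphisms. -/
def sheafStruc (X : TopCat.{u}) (D : Type u) : Struc X D where
  Obj := Sh X
  conn :=
    { verum := ⊤_ (Sh X)
      falsum := ⊥_ (Sh X)
      and := fun F G => F ⨯ G
      or := fun F G => F ⨿ G
      imp := fun F G => sheafHom F G
      all := fun F => ∏ᶜ F
      ex := fun F => ∐ F }
  bang := fun P => interiorSheaf X P
  wn := fun F => stalkSupport F.obj
  Solvable := fun F => Nonempty (F.obj.obj (op ⊤))

/-- Presheaves of sets on `X` with at least one section over the empty set. (The stronger condition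
of having exactly one such section is not preserved by pointwise disjoint unions.) -/
def PSh (X : TopCat.{u}) : Type (u + 1) :=
  {F : TopCat.Presheaf (Type u) X // Nonempty (F.obj (op ⊥))}

/-- A section over the empty set, from a section over the empty set of another presheaf. -/
theorem nonempty_of_hom {X : TopCat.{u}} {F G : TopCat.Presheaf (Type u) X} (f : F ⟶ G)
    (h : Nonempty (F.obj (op ⊥))) : Nonempty (G.obj (op ⊥)) :=
  h.map (fun x => f.app (op ⊥) x)

/-- A section over the empty set as a morphism from a representable presheaf. -/
theorem nonempty_iff {X : TopCat.{u}} (F : TopCat.Presheaf (Type u) X) :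
    Nonempty (F.obj (op ⊥)) ↔ Nonempty (yoneda.obj (⊥ : Opens X) ⟶ F) :=
  ⟨fun ⟨x⟩ => ⟨yonedaEquiv.symm x⟩, fun ⟨f⟩ => ⟨yonedaEquiv f⟩⟩

theorem nonempty_presheafHom {X : TopCat.{u}} {F G : TopCat.Presheaf (Type u) X}
    (h : Nonempty (G.obj (op ⊥))) : Nonempty ((presheafHom F G).obj (op ⊥)) := by
  obtain ⟨y⟩ := h
  refine ⟨{ app := fun W => ↾fun _ => G.map W.unop.hom.op y, naturality := ?_ }⟩
  intro W W' f
  ext z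
  have h := congrArg (fun g => g y) (G.map_comp W.unop.hom.op f.unop.left.op)
  rw [← op_comp, Over.w] at h
  exact h

/-- The subset/presheaf-valued structure over `X` with domain `D`. Triviality, conjunction,
disjunction and quantifiers are interpreted by the terminal object, products and coproducts in the
category of presheaves, implication by the presheaf of homomorphisms, and absurdity
by the presheaf of sections of the inclusion of the empty set into `X`. -/
def presheafStruc (X : TopCat.{u}) (D : Type u) [Nonempty D] : Struc X D where
  Obj := PSh X
  conn :=
    { verum := ⟨⊤_ (TopCat.Presheaf (Type u) X),
        (nonempty_iff _).2 ⟨terminal.from _⟩⟩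
      falsum := ⟨(interiorSheaf X ∅).obj, nonempty_interiorSheaf X ∅⟩
      and := fun F G => ⟨F.1 ⨯ G.1, (nonempty_iff _).2
        ⟨prod.lift ((nonempty_iff _).1 F.2).some ((nonempty_iff _).1 G.2).some⟩⟩
      or := fun F G => ⟨F.1 ⨿ G.1, nonempty_of_hom coprod.inl F.2⟩
      imp := fun F G => ⟨presheafHom F.1 G.1, nonempty_presheafHom G.2⟩
      all := fun F => ⟨∏ᶜ fun d => (F d).1, (nonempty_iff _).2
        ⟨Pi.lift fun d => ((nonempty_iff _).1 (F d).2).some⟩⟩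
      ex := fun F => ⟨∐ fun d => (F d).1,
        nonempty_of_hom (Sigma.ι (fun d => (F d).1) (Classical.arbitrary D))
          (F (Classical.arbitrary D)).2⟩ }
  bang := fun P => ⟨(interiorSheaf X P).obj, nonempty_interiorSheaf X P⟩
  wn := fun F => stalkSupport F.1
  Solvable := fun F => Nonempty (F.1.obj (op ⊤))

end

end QHC

/-!
Order the values of i-formulas by existence of a morphism: `F ≤ G` when `F ⟶ G` is nonempty. Only
the existence of global sections matters for validity, so only this preorder matters.

The universal properties of products, coproducts, terminal objects and internal homs say that it is
a Heyting preorder with meets and joins of `D`-indexed families (`Connectives.IsHeyting`). The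
greatest elements are exactly the values with a global section, and so the laws and rules of
intuitionistic predicate logic are sound. Subsets of `X` ordered by inclusion form a Heyting
preorder too, which leaves only excluded middle to be checked for c-formulas.

All laws and rules that relate the two sorts follow from the adjunction `wn F ⊆ P ↔ F ≤ bang P`
(`stalkSupport_subset_iff`) together with three facts: `wn` of the terminal object is `X`,
`wn F ∩ wn G ⊆ wn (F × G)`, and `bang ∅` lies below absurdity. In particular, `wn` preserves
coproducts because it is a left adjoint, so stalks of coproducts of sheaves, and hence
sheafification, need not be computed. The resulting soundness theorem is `Struc.IsAdjoint.isModel`;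
its hypotheses are verified in `sheafStruc_isAdjoint` and `presheafStruc_isAdjoint`.
-/

namespace QHC

/-! ### Intuitionistic laws in a Heyting preorder -/

/-- The operations `C` are those of a Heyting algebra with meets and joins of `D`-indexed families,
up to the equivalence relation of the preorder `le`. -/
structure Connectives.IsHeyting {D : Type u} {V : Type (u + 1)} (C : Connectives D V)
    (le : V → V → Prop) : Prop where
  refl (F : V) : le F F
  trans {F G H : V} : le F G → le G H → le F H
  le_verum (F : V) : le F C.verum
  falsum_le (F : V) : le C.falsum F
  le_and {F G H : V} : le H (C.and F G) ↔ le H F ∧ le H G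
  or_le {F G H : V} : le (C.or F G) H ↔ le F H ∧ le G H
  le_imp {F G H : V} : le H (C.imp F G) ↔ le (C.and H F) G
  le_all {F : D → V} {H : V} : le H (C.all F) ↔ ∀ d, le H (F d)
  ex_le {F : D → V} {H : V} : le (C.ex F) H ↔ ∀ d, le (F d) H

namespace Connectives.IsHeyting

variable {D : Type u} {V : Type (u + 1)} {C : Connectives D V} {le : V → V → Prop}

theorem and_left (h : C.IsHeyting le) (F G : V) : le (C.and F G) F :=
  (h.le_and.1 (h.refl _)).1

theorem and_right (h : C.IsHeyting le) (F G : V) : le (C.and F G) G :=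
  (h.le_and.1 (h.refl _)).2

theorem le_or_left (h : C.IsHeyting le) (F G : V) : le F (C.or F G) :=
  (h.or_le.1 (h.refl _)).1

theorem le_or_right (h : C.IsHeyting le) (F G : V) : le G (C.or F G) :=
  (h.or_le.1 (h.refl _)).2

theorem all_le (h : C.IsHeyting le) (F : D → V) (d : D) : le (C.all F) (F d) :=
  h.le_all.1 (h.refl _) d

theorem le_ex (h : C.IsHeyting le) (F : D → V) (d : D) : le (F d) (C.ex F) :=
  h.ex_le.1 (h.refl _) d

theorem modus_ponens (h : C.IsHeyting le) {F G H : V} (h₁ : le H (C.imp F G)) (h₂ : le H F) :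
    le H G :=
  h.trans (h.le_and.2 ⟨h.refl _, h₂⟩) (h.le_imp.1 h₁)

theorem verum_le_imp (h : C.IsHeyting le) {F G : V} : le C.verum (C.imp F G) ↔ le F G :=
  h.le_imp.trans ⟨h.trans (h.le_and.2 ⟨h.le_verum _, h.refl _⟩), h.trans (h.and_right _ _)⟩

theorem imp_k (h : C.IsHeyting le) (F G : V) : le F (C.imp G F) :=
  h.le_imp.2 (h.and_left _ _)

theorem and_intro (h : C.IsHeyting le) (F G : V) : le F (C.imp G (C.and F G)) :=
  h.le_imp.2 (h.refl _)

theorem imp_s (h : C.IsHeyting le) (F G H : V) :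
    le (C.imp F (C.imp G H)) (C.imp (C.imp F G) (C.imp F H)) := by
  refine h.le_imp.2 (h.le_imp.2 ?_)
  have hF := h.and_right (C.and (C.imp F (C.imp G H)) (C.imp F G)) F
  have hl := h.and_left (C.and (C.imp F (C.imp G H)) (C.imp F G)) F
  exact h.modus_ponens
    (h.modus_ponens (h.trans hl (h.and_left _ _)) hF)
    (h.modus_ponens (h.trans hl (h.and_right _ _)) hF)

theorem or_elim (h : C.IsHeyting le) (F G H : V) :
    le (C.imp F H) (C.imp (C.imp G H) (C.imp (C.or F G) H)) := by
  refine h.le_imp.2 (h.le_imp.2 ?_)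
  -- Disjunction elimination in a context `K`, by moving `K` to the right of the disjunction.
  have key : le (C.or F G) (C.imp (C.and (C.imp F H) (C.imp G H)) H) :=
    h.or_le.2 ⟨
      h.le_imp.2 (h.modus_ponens (h.trans (h.and_right _ _) (h.and_left _ _)) (h.and_left _ _)),
      h.le_imp.2 (h.modus_ponens (h.trans (h.and_right _ _) (h.and_right _ _)) (h.and_left _ _))⟩
  exact h.modus_ponens (h.trans (h.and_right _ _) key) (h.and_left _ _)

end Connectives.IsHeyting

theorem subsetConnectives_isHeyting (X D : Type u) :
    (subsetConnectives X D).IsHeyting (fun P Q => P.down ⊆ Q.down) where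
  refl _ := subset_rfl
  trans := Set.Subset.trans
  le_verum _ := Set.subset_univ _
  falsum_le _ := Set.empty_subset _
  le_and := Set.subset_inter_iff
  or_le := Set.union_subset_iff
  le_imp {F G H} := by
    refine ⟨fun h x hx => (h hx.1).resolve_left fun hn => hn hx.2, fun h x hx => ?_⟩
    by_cases hF : x ∈ F.down
    · exact Or.inr (h ⟨hx, hF⟩)
    · exact Or.inl hF
  le_all := Set.subset_iInter_iff
  ex_le := Set.iUnion_subset_iff

/-! ### Evaluation and substitution -/

namespace Struc

variable {X D : Type u} (M : Struc X D) (v : M.Valuation)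

theorem cons_comp_liftVar (d : D) (e : ℕ → D) (f : ℕ → ℕ) :
    (fun n => cons d e (Formula.liftVar f n)) = cons d (fun n => e (f n)) := by
  funext n
  cases n <;> rfl

theorem eval_rename {s : Kind} (A : Formula s) (f : ℕ → ℕ) (e : ℕ → D) :
    M.eval v (A.rename f) e = M.eval v A (fun n => e (f n)) := by
  induction A generalizing f e with
  | atom | verum | falsum => rfl
  | and A B hA hB => simp only [Formula.rename, eval, hA, hB]
  | or A B hA hB => simp only [Formula.rename, eval, hA, hB]
  | imp A B hA hB => simp only [Formula.rename, eval, hA, hB]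
  | all A hA => simp only [Formula.rename, eval, hA, cons_comp_liftVar]
  | ex A hA => simp only [Formula.rename, eval, hA, cons_comp_liftVar]
  | bang A hA => exact congrArg (fun P => M.bang P.down) (hA f e)
  | wn A hA => exact congrArg (fun F => (⟨M.wn F⟩ : ULift (Set X))) (hA f e)

/-- Under `cons d e`, the shifted premisses of the quantifier rules have the values that the
original premisses have under `e`. -/
theorem eval_shift {s : Kind} (A : Formula s) (d : D) (e : ℕ → D) :
    M.eval v A.shift (cons d e) = M.eval v A e :=
  M.eval_rename v A Nat.succ (cons d e)

theorem eval_inst {s : Kind} (A : Formula s) (x : ℕ) (e : ℕ → D) :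
    M.eval v (A.inst x) e = M.eval v A (cons (e x) e) := by
  refine (M.eval_rename v A _ e).trans (congrArg _ (funext fun n => ?_))
  cases n <;> rfl

/-! ### Soundness for structures in which `?` is left adjoint to `!` -/

variable {M} in
/-- Inclusion of subsets for c-formulas, and a given preorder for i-formulas. -/
def kindLe (le : M.Obj → M.Obj → Prop) : (s : Kind) → M.Val s → M.Val s → Prop
  | Kind.c => fun P Q => P.down ⊆ Q.down
  | Kind.i => le

/-- The i-values of `M` form a Heyting preorder under `le` whose valid elements are the greatest
ones, `wn` is left adjoint to `bang`, preserves finite meets, and `bang ∅` is a least element. -/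
structure IsAdjoint (le : M.Obj → M.Obj → Prop) : Prop where
  isHeyting : M.conn.IsHeyting le
  solvable_iff (F : M.Obj) : M.Solvable F ↔ le M.conn.verum F
  wn_subset_iff (F : M.Obj) (P : Set X) : M.wn F ⊆ P ↔ le F (M.bang P)
  wn_verum : M.wn M.conn.verum = Set.univ
  inter_subset_wn (F G : M.Obj) : M.wn F ∩ M.wn G ⊆ M.wn (M.conn.and F G)
  bang_empty_le : le (M.bang ∅) M.conn.falsum

namespace IsAdjoint

variable {M} {le : M.Obj → M.Obj → Prop}

theorem isHeyting_ops (h : M.IsAdjoint le) : (s : Kind) → (M.ops s).IsHeyting (kindLe le s)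
  | Kind.c => subsetConnectives_isHeyting X D
  | Kind.i => h.isHeyting

theorem valid_iff (h : M.IsAdjoint le) :
    (s : Kind) → (F : M.Val s) → (M.Valid s F ↔ kindLe le s (M.ops s).verum F)
  | Kind.c, _ => Set.univ_subset_iff.symm
  | Kind.i, F => h.solvable_iff F

theorem valid_imp (h : M.IsAdjoint le) {s : Kind} {F G : M.Val s} :
    M.Valid s ((M.ops s).imp F G) ↔ kindLe le s F G :=
  (h.valid_iff s _).trans (h.isHeyting_ops s).verum_le_imp

theorem valid_and_imp_imp (h : M.IsAdjoint le) {s : Kind} {F G : M.Val s} :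
    M.Valid s ((M.ops s).and ((M.ops s).imp F G) ((M.ops s).imp G F)) ↔
      kindLe le s F G ∧ kindLe le s G F := by
  rw [h.valid_iff, (h.isHeyting_ops s).le_and, (h.isHeyting_ops s).verum_le_imp,
    (h.isHeyting_ops s).verum_le_imp]

theorem wn_mono (h : M.IsAdjoint le) {F G : M.Obj} (hFG : le F G) : M.wn F ⊆ M.wn G :=
  (h.wn_subset_iff _ _).2 (h.isHeyting.trans hFG ((h.wn_subset_iff _ _).1 subset_rfl))

theorem wn_bang_subset (h : M.IsAdjoint le) (P : Set X) : M.wn (M.bang P) ⊆ P :=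
  (h.wn_subset_iff _ _).2 (h.isHeyting.refl _)

theorem le_bang_wn (h : M.IsAdjoint le) (F : M.Obj) : le F (M.bang (M.wn F)) :=
  (h.wn_subset_iff _ _).1 subset_rfl

theorem wn_falsum (h : M.IsAdjoint le) : M.wn M.conn.falsum ⊆ ∅ :=
  (h.wn_subset_iff _ _).2 (h.isHeyting.falsum_le _)

/-- As a left adjoint, `wn` preserves joins. -/
theorem wn_or (h : M.IsAdjoint le) (F G : M.Obj) : M.wn (M.conn.or F G) ⊆ M.wn F ∪ M.wn G :=
  (h.wn_subset_iff _ _).2 (h.isHeyting.or_le.2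
    ⟨(h.wn_subset_iff _ _).1 Set.subset_union_left, (h.wn_subset_iff _ _).1 Set.subset_union_right⟩)

theorem wn_ex (h : M.IsAdjoint le) (F : D → M.Obj) : M.wn (M.conn.ex F) ⊆ ⋃ d, M.wn (F d) :=
  (h.wn_subset_iff _ _).2 (h.isHeyting.ex_le.2 fun d =>
    (h.wn_subset_iff _ _).1 (Set.subset_iUnion (fun d => M.wn (F d)) d))

theorem wn_imp (h : M.IsAdjoint le) (F G : M.Obj) :
    M.wn (M.conn.imp F G) ∩ M.wn F ⊆ M.wn G :=
  (h.inter_subset_wn _ _).trans (h.wn_mono (h.isHeyting.le_imp.1 (h.isHeyting.refl _)))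

theorem bang_imp (h : M.IsAdjoint le) (P Q : Set X) :
    le (M.conn.and (M.bang (Pᶜ ∪ Q)) (M.bang P)) (M.bang Q) := by
  refine (h.wn_subset_iff _ _).1 fun x hx => ?_
  have h₁ := h.wn_bang_subset _ (h.wn_mono (h.isHeyting.and_left _ _) hx)
  have h₂ := h.wn_bang_subset _ (h.wn_mono (h.isHeyting.and_right _ _) hx)
  exact h₁.resolve_left fun hn => hn h₂

theorem solvable_bang (h : M.IsAdjoint le) (P : Set X) : M.Solvable (M.bang P) ↔ P = Set.univ := by
  rw [h.solvable_iff, ← h.wn_subset_iff, h.wn_verum, Set.univ_subset_iff]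

theorem valid_of_law (h : M.IsAdjoint le) (v : M.Valuation) {s : Kind} {A : Formula s}
    (hA : Law A) (e : ℕ → D) : M.Valid s (M.eval v A e) := by
  have hs := h.isHeyting_ops s
  cases hA with
  | imp_k => exact h.valid_imp.2 (hs.imp_k _ _)
  | imp_s => exact h.valid_imp.2 (hs.imp_s _ _ _)
  | and_left => exact h.valid_imp.2 (hs.and_left _ _)
  | and_right => exact h.valid_imp.2 (hs.and_right _ _)
  | and_intro => exact h.valid_imp.2 (hs.and_intro _ _)
  | or_left => exact h.valid_imp.2 (hs.le_or_left _ _)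
  | or_right => exact h.valid_imp.2 (hs.le_or_right _ _)
  | or_elim => exact h.valid_imp.2 (hs.or_elim _ _ _)
  | explosion => exact h.valid_imp.2 (hs.falsum_le _)
  | verum => exact (h.valid_iff s _).2 (hs.refl _)
  | all_elim A x =>
    refine h.valid_imp.2 ?_
    rw [eval_inst]
    exact hs.all_le (fun d => M.eval v A (cons d e)) (e x)
  | ex_intro A x =>
    refine h.valid_imp.2 ?_
    rw [eval_inst]
    exact hs.le_ex (fun d => M.eval v A (cons d e)) (e x)
  | em F =>
    refine Set.eq_univ_of_forall fun x => ?_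
    by_cases hx : x ∈ (M.eval v F e).down
    · exact Or.inl hx
    · exact Or.inr (Or.inl hx)
  | wn_and =>
    exact h.valid_and_imp_imp.2
      ⟨Set.subset_inter (h.wn_mono (h.isHeyting.and_left _ _))
        (h.wn_mono (h.isHeyting.and_right _ _)), h.inter_subset_wn _ _⟩
  | wn_or =>
    exact h.valid_and_imp_imp.2
      ⟨h.wn_or _ _, Set.union_subset (h.wn_mono (h.isHeyting.le_or_left _ _))
        (h.wn_mono (h.isHeyting.le_or_right _ _))⟩
  | wn_imp => exact h.valid_imp.2 (hs.le_imp.2 (h.wn_imp _ _))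
  | wn_absurd => exact h.valid_imp.2 h.wn_falsum
  | wn_ex Φ =>
    exact h.valid_and_imp_imp.2 ⟨h.wn_ex _, Set.iUnion_subset fun d =>
      h.wn_mono (h.isHeyting.le_ex (fun d => M.eval v Φ (cons d e)) d)⟩
  | wn_all Φ =>
    exact h.valid_imp.2 (Set.subset_iInter fun d =>
      h.wn_mono (h.isHeyting.all_le (fun d => M.eval v Φ (cons d e)) d))
  | bang_wn => exact h.valid_imp.2 (h.le_bang_wn _)
  | bang_false => exact h.valid_imp.2 h.bang_empty_le
  | wn_bang => exact h.valid_imp.2 (h.wn_bang_subset _)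
  | bang_wn_bang => exact h.valid_imp.2 (h.le_bang_wn _)
  | bang_imp => exact h.valid_imp.2 (hs.le_imp.2 (h.bang_imp _ _))

/-- Soundness, by induction on derivations. The assignment is universally quantified in the
induction hypothesis, since the quantifier rules move from `e` to all `cons d e`. -/
theorem isModel (h : M.IsAdjoint le) : M.IsModel := by
  intro Γ s A hA v
  induction hA with
  | hyp hB => exact fun e hΓ => hΓ _ hB
  | law hA => exact fun e _ => h.valid_of_law v hA e
  | mp _ _ ih₁ ih₂ =>
    exact fun e hΓ => (h.valid_iff _ _).2
      ((h.isHeyting_ops _).trans ((h.valid_iff _ _).1 (ih₂ e hΓ)) (h.valid_imp.1 (ih₁ e hΓ)))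
  | @all_rule Γ s A B _ ih =>
    intro e hΓ
    refine h.valid_imp.2 ((h.isHeyting_ops s).le_all.2 fun d => ?_)
    rw [← M.eval_shift v A d e]
    refine h.valid_imp.1 (ih (cons d e) ?_)
    rintro _ ⟨C, hC, rfl⟩
    exact (M.eval_shift v C.2 d e).symm ▸ hΓ C hC
  | @ex_rule Γ s A B _ ih =>
    intro e hΓ
    refine h.valid_imp.2 ((h.isHeyting_ops s).ex_le.2 fun d => ?_)
    rw [← M.eval_shift v A d e]
    refine h.valid_imp.1 (ih (cons d e) ?_)
    rintro _ ⟨C, hC, rfl⟩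
    exact (M.eval_shift v C.2 d e).symm ▸ hΓ C hC
  | bang_elim _ ih => exact fun e hΓ => (h.solvable_bang _).1 (ih e hΓ)
  | bang_intro _ ih => exact fun e hΓ => (h.solvable_bang _).2 (ih e hΓ)

end IsAdjoint

end Struc

/-! ### Presheaves of sets -/

section Presheaf

variable {X : TopCat.{u}}

theorem mem_stalkSupport_iff {F : TopCat.Presheaf (Type u) X} {x : X} :
    x ∈ stalkSupport F ↔ ∃ U : Opens X, x ∈ U ∧ Nonempty (F.obj (op U)) := by
  refine ⟨fun ⟨t⟩ => ?_, fun ⟨U, hx, ⟨s⟩⟩ => ⟨F.germ U x hx s⟩⟩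
  obtain ⟨U, hx, s, _⟩ := F.exists_germ_eq t
  exact ⟨U, hx, ⟨s⟩⟩

theorem nonempty_interiorSheaf_obj_iff (P : Set X) (U : Opens X) :
    Nonempty ((interiorSheaf X P).obj.obj (op U)) ↔ (U : Set X) ⊆ P := by
  constructor
  · rintro ⟨s⟩ x hx
    have h : ((s.1 ⟨x, hx⟩ : interior P) : X) = x := congrFun s.2.2 ⟨x, hx⟩
    exact interior_subset (h ▸ (s.1 ⟨x, hx⟩).2)
  · intro h
    exact ⟨⟨fun x => ⟨x.1, interior_maximal h U.isOpen x.2⟩,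
      continuous_subtype_val.subtype_mk _, rfl⟩⟩

instance subsingleton_interiorSheaf_obj (P : Set X) (U : (Opens X)ᵒᵖ) :
    Subsingleton ((interiorSheaf X P).obj.obj U) :=
  ⟨fun s t => Subtype.ext (funext fun x => Subtype.ext
    ((congrFun s.2.2 x).trans (congrFun t.2.2 x).symm))⟩

/-- The support functor is left adjoint to the interior sheaf functor: a section over an open set
`U` forces every point of `U` into the support, so `U` lies in the interior of any `P` that contains
the support. -/
theorem stalkSupport_subset_iff (F : TopCat.Presheaf (Type u) X) (P : Set X) :
    stalkSupport F ⊆ P ↔ Nonempty (F ⟶ (interiorSheaf X P).obj) := by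
  constructor
  · intro h
    have hs (U : (Opens X)ᵒᵖ) (s : F.obj U) : Nonempty ((interiorSheaf X P).obj.obj U) :=
      (nonempty_interiorSheaf_obj_iff P U.unop).2 fun x hx =>
        h (mem_stalkSupport_iff.2 ⟨U.unop, hx, ⟨s⟩⟩)
    exact ⟨{ app U := ↾fun s => (hs U s).some
             naturality _ _ _ := by ext; exact Subsingleton.elim _ _ }⟩
  · rintro ⟨f⟩ x hx
    obtain ⟨U, hxU, ⟨s⟩⟩ := mem_stalkSupport_iff.1 hx
    exact (nonempty_interiorSheaf_obj_iff P U).1 ⟨f.app (op U) s⟩ hxU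

/-- The sheaf of sections of the empty set has no sections over nonempty open sets, so the only
condition for mapping it to `F` is that `F` has a section over the empty set. -/
theorem nonempty_interiorSheaf_empty_hom {F : TopCat.Presheaf (Type u) X}
    (h : Nonempty (F.obj (op ⊥))) : Nonempty ((interiorSheaf X ∅).obj ⟶ F) := by
  obtain ⟨y⟩ := h
  have hU (U : (Opens X)ᵒᵖ) (s : (interiorSheaf X ∅).obj.obj U) : U.unop ≤ ⊥ :=
    (nonempty_interiorSheaf_obj_iff ∅ U.unop).1 ⟨s⟩
  refine ⟨{ app U := ↾fun s => F.map (homOfLE (hU U s)).op y, naturality := ?_ }⟩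
  intro U V f
  ext s
  exact congrArg (fun g => g y) (F.map_comp (homOfLE (hU U s)).op f)

/-- The restrictions of a global section of `F` form a morphism to `F` from any presheaf. For `T`
terminal, this says that the greatest elements of the preorder are the objects with a global
section. -/
theorem nonempty_obj_top_iff {T F : TopCat.Presheaf (Type u) X}
    (hT : Nonempty (T.obj (op ⊤))) : Nonempty (F.obj (op ⊤)) ↔ Nonempty (T ⟶ F) := by
  constructor
  · rintro ⟨y⟩
    refine ⟨{ app U := ↾fun _ => F.map (homOfLE le_top).op y, naturality := ?_ }⟩
    intro U V f
    ext s
    exact congrArg (fun g => g y) (F.map_comp (homOfLE le_top).op f)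
  · rintro ⟨f⟩
    exact hT.map (f.app (op ⊤))

theorem stalkSupport_eq_univ {F : TopCat.Presheaf (Type u) X} (h : Nonempty (F.obj (op ⊤))) :
    stalkSupport F = Set.univ :=
  Set.eq_univ_of_forall fun _ => mem_stalkSupport_iff.2 ⟨⊤, trivial, h⟩

theorem inter_subset_stalkSupport_prod (F G : TopCat.Presheaf (Type u) X) :
    stalkSupport F ∩ stalkSupport G ⊆ stalkSupport (FunctorToTypes.prod F G) := by
  rintro x ⟨hF, hG⟩
  obtain ⟨U, hU, ⟨s⟩⟩ := mem_stalkSupport_iff.1 hF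
  obtain ⟨V, hV, ⟨t⟩⟩ := mem_stalkSupport_iff.1 hG
  exact mem_stalkSupport_iff.2 ⟨U ⊓ V, ⟨hU, hV⟩,
    ⟨(F.map (homOfLE inf_le_left).op s, G.map (homOfLE inf_le_right).op t)⟩⟩

theorem stalkSupport_mono {F G : TopCat.Presheaf (Type u) X} (f : F ⟶ G) :
    stalkSupport F ⊆ stalkSupport G := by
  intro x hx
  obtain ⟨U, hxU, hs⟩ := mem_stalkSupport_iff.1 hx
  exact mem_stalkSupport_iff.2 ⟨U, hxU, hs.map (f.app (op U))⟩

/-- Currying: the internal hom of presheaves is right adjoint to the pointwise product, as far as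
the existence of morphisms is concerned. -/
theorem nonempty_hom_presheafHom_iff (F G H : TopCat.Presheaf (Type u) X) :
    Nonempty (H ⟶ presheafHom F G) ↔ Nonempty (FunctorToTypes.prod H F ⟶ G) := by
  constructor
  · rintro ⟨f⟩
    refine ⟨{ app U := ↾fun p => (f.app U p.1).app (op (Over.mk (𝟙 U.unop))) p.2
              naturality := ?_ }⟩
    intro U V g
    ext p
    -- Naturality of `f` at `g`, followed by naturality of the homomorphism `f.app U p.1` of
    -- restricted presheaves along `g`, regarded as a morphism to the terminal object of `Over U`.
    have h₁ : f.app V (H.map g p.1) = (presheafHom F G).map g (f.app U p.1) :=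
      congrArg (fun k => k p.1) (f.naturality g)
    have h₂ := presheafHom_map_app_op_mk_id g.unop (f.app U p.1)
    have h₃ := congrArg (fun k => k p.2) ((f.app U p.1).naturality
      (Over.homMk g.unop : Over.mk g.unop ⟶ Over.mk (𝟙 U.unop)).op)
    refine Eq.trans ?_ h₃
    exact (congrArg (fun φ => φ.app (op (Over.mk (𝟙 V.unop))) (F.map g p.2)) h₁).trans
      (congrArg (fun k => k (F.map g p.2)) h₂)
  · rintro ⟨f⟩
    refine ⟨{ app U := ↾fun h =>
                { app W := ↾fun s => f.app (op W.unop.left) (H.map W.unop.hom.op h, s)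
                  naturality := ?_ }
              naturality := ?_ }⟩
    · intro W W' g
      ext s
      have h₁ : H.map W'.unop.hom.op h = H.map g.unop.left.op (H.map W.unop.hom.op h) :=
        congrArg (fun k => k h) (H.map_comp W.unop.hom.op g.unop.left.op)
      have h₂ := congrArg (fun k => k (H.map W.unop.hom.op h, s)) (f.naturality g.unop.left.op)
      refine Eq.trans ?_ h₂
      exact congrArg (fun a => f.app (op W'.unop.left) (a, F.map g.unop.left.op s)) h₁
    · intro U V g
      ext h
      refine NatTrans.ext (funext fun W => ?_)
      ext s
      have h₁ : H.map W.unop.hom.op (H.map g h) = H.map (W.unop.hom ≫ g.unop).op h :=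
        (congrArg (fun k => k h) (H.map_comp g W.unop.hom.op)).symm
      exact congrArg (fun a => f.app (op W.unop.left) (a, s)) h₁

end Presheaf

/-! ### The two structures -/

noncomputable section

variable (X : TopCat.{u})

/-- Binary products of sheaves are computed on each open set. -/
def sheafProdIso (F G : Sh X) : (F ⨯ G).obj ≅ FunctorToTypes.prod F.obj G.obj :=
  PreservesLimitPair.iso (sheafToPresheaf _ _) F G ≪≫ FunctorToTypes.binaryProductIso _ _

theorem nonempty_sheaf_hom_iff (F G : Sh X) : Nonempty (F ⟶ G) ↔ Nonempty (F.obj ⟶ G.obj) :=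
  ⟨fun ⟨f⟩ => ⟨f.hom⟩, fun ⟨f⟩ => ⟨⟨f⟩⟩⟩

theorem nonempty_hom_sheafHom_iff (F G H : Sh X) :
    Nonempty (H ⟶ sheafHom F G) ↔ Nonempty (H ⨯ F ⟶ G) := by
  rw [nonempty_sheaf_hom_iff, nonempty_sheaf_hom_iff,
    ((sheafProdIso X H F).homCongr (Iso.refl G.obj)).nonempty_congr]
  exact ((Iso.refl H.obj).homCongr (sheafHom'Iso F G)).nonempty_congr.trans
    (nonempty_hom_presheafHom_iff F.obj G.obj H.obj)

theorem nonempty_obj_bot (F : Sh X) : Nonempty (F.obj.obj (op ⊥)) :=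
  ⟨(TopCat.Sheaf.isTerminalOfEmpty F).from PUnit.{u + 1} PUnit.unit⟩

theorem nonempty_interiorSheaf_univ : Nonempty ((interiorSheaf X Set.univ).obj.obj (op ⊤)) :=
  (nonempty_interiorSheaf_obj_iff _ _).2 (Set.subset_univ _)

/-- Absurdity and `bang ∅` agree because a sheaf has a section over the empty set. -/
theorem sheafStruc_isAdjoint (D : Type u) :
    (sheafStruc X D).IsAdjoint (fun F G : Sh X => Nonempty (F ⟶ G)) := by
  have hT : Nonempty ((⊤_ (Sh X)).obj.obj (op ⊤)) :=
    (nonempty_interiorSheaf_univ X).map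
      ((terminal.from (interiorSheaf X Set.univ) : _ ⟶ ⊤_ (Sh X)).hom.app (op ⊤))
  exact {
    isHeyting :=
      { refl F := ⟨@CategoryStruct.id (Sh X) _ F⟩
        trans := fun ⟨f⟩ ⟨g⟩ => ⟨f ≫ g⟩
        le_verum _ := ⟨terminal.from _⟩
        falsum_le _ := ⟨initial.to _⟩
        le_and := ⟨fun ⟨f⟩ => ⟨⟨f ≫ prod.fst⟩, ⟨f ≫ prod.snd⟩⟩, fun ⟨⟨f⟩, ⟨g⟩⟩ => ⟨prod.lift f g⟩⟩
        or_le := ⟨fun ⟨f⟩ => ⟨⟨coprod.inl ≫ f⟩, ⟨coprod.inr ≫ f⟩⟩,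
          fun ⟨⟨f⟩, ⟨g⟩⟩ => ⟨coprod.desc f g⟩⟩
        le_imp := nonempty_hom_sheafHom_iff X _ _ _
        le_all := ⟨fun ⟨f⟩ d => ⟨f ≫ Pi.π _ d⟩, fun h => ⟨Pi.lift fun d => (h d).some⟩⟩
        ex_le := ⟨fun ⟨f⟩ d => ⟨Sigma.ι _ d ≫ f⟩, fun h => ⟨Sigma.desc fun d => (h d).some⟩⟩ }
    solvable_iff F := (nonempty_obj_top_iff hT).trans (nonempty_sheaf_hom_iff X _ F).symm
    wn_subset_iff F P := (stalkSupport_subset_iff _ P).trans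
      (nonempty_sheaf_hom_iff X F (interiorSheaf X P)).symm
    wn_verum := stalkSupport_eq_univ hT
    inter_subset_wn F G := (inter_subset_stalkSupport_prod _ _).trans
      (stalkSupport_mono (sheafProdIso X F G).inv)
    bang_empty_le := (nonempty_sheaf_hom_iff X _ _).2
      (nonempty_interiorSheaf_empty_hom (nonempty_obj_bot X _)) }

/-- Absurdity is a least element because the presheaves of the structure have a section over the
empty set; the initial presheaf is not among them. -/
theorem presheafStruc_isAdjoint (D : Type u) [Nonempty D] :
    (presheafStruc X D).IsAdjoint (fun F G : PSh X => Nonempty (F.1 ⟶ G.1)) := by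
  have hT : Nonempty ((⊤_ (TopCat.Presheaf (Type u) X)).obj (op ⊤)) :=
    (nonempty_interiorSheaf_univ X).map
      ((terminal.from (interiorSheaf X Set.univ).obj :
        _ ⟶ ⊤_ (TopCat.Presheaf (Type u) X)).app (op ⊤))
  exact {
    isHeyting :=
      { refl F := ⟨𝟙 F.1⟩
        trans := fun ⟨f⟩ ⟨g⟩ => ⟨f ≫ g⟩
        le_verum _ := ⟨terminal.from _⟩
        falsum_le F := nonempty_interiorSheaf_empty_hom F.2
        le_and := ⟨fun ⟨f⟩ => ⟨⟨f ≫ prod.fst⟩, ⟨f ≫ prod.snd⟩⟩, fun ⟨⟨f⟩, ⟨g⟩⟩ => ⟨prod.lift f g⟩⟩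
        or_le := ⟨fun ⟨f⟩ => ⟨⟨coprod.inl ≫ f⟩, ⟨coprod.inr ≫ f⟩⟩,
          fun ⟨⟨f⟩, ⟨g⟩⟩ => ⟨coprod.desc f g⟩⟩
        le_imp {F G H} := (nonempty_hom_presheafHom_iff F.1 G.1 H.1).trans
          ((FunctorToTypes.binaryProductIso H.1 F.1).symm.homCongr (Iso.refl _)).nonempty_congr
        le_all := ⟨fun ⟨f⟩ d => ⟨f ≫ Pi.π _ d⟩, fun h => ⟨Pi.lift fun d => (h d).some⟩⟩
        ex_le {F _} := ⟨fun ⟨f⟩ d => ⟨Sigma.ι (fun d => (F d).1) d ≫ f⟩,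
          fun h => ⟨Sigma.desc fun d => (h d).some⟩⟩ }
    solvable_iff _ := nonempty_obj_top_iff hT
    wn_subset_iff F P := stalkSupport_subset_iff F.1 P
    wn_verum := stalkSupport_eq_univ hT
    inter_subset_wn F G := (inter_subset_stalkSupport_prod F.1 G.1).trans
      (stalkSupport_mono (FunctorToTypes.binaryProductIso F.1 G.1).inv)
    bang_empty_le := ⟨𝟙 _⟩ }

end

end QHC

theorem mainTheorem5 (X : TopCat.{u}) (D : Type u) [Nonempty D] :
    (QHC.sheafStruc X D).IsModel ∧ (QHC.presheafStruc X D).IsModel :=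
  ⟨(QHC.sheafStruc_isAdjoint X D).isModel, (QHC.presheafStruc_isAdjoint X D).isModel⟩
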